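/- Conventions. Let $\mathbb S^{d-1}$ be the unit sphere of $\mathbb R^d$ with normalized Lebesgue measure $\mu_d$. A finite nonempty set $X\subset\mathbb S^{d-1}$ is a spherical $t$-design if $\int_{\mathbb S^{d-1}} f\,d\mu_d=\frac1{|X|}\sum_{x\in X}f(x)$ for every real polynomial $f$ of degree at most $t$. A spherical $5$-design in $\mathbb S^{d-1}$ is tight if $|X|=2\binom{d+1}{2}=d(d+1)$. A spherical $5$-design $D\subset\mathbb S^{d-1}$ is of minimal type if there is a nonzero $\alpha\in\mathbb R^d$ with $\langle\alpha,x\rangle\in\{0,\pm1\}$ for all $x\in D$; for such an $\alpha$ put $$\mathcal L_{\alpha,0}(D)=\{x\in D:\langle\alpha,x\rangle=0\}\subset\mathbb S^{d-1}\cap\alpha^{\perp}.$$ A half of a set $S=-S$ of nonzero vectors is a subset $Y$ with $Y\cup(-Y)=S$ and $Y\cap(-Y)=\emptyset$. An equiangular tight frame (ETF) with parameters $(l,n)$, $n>l$, is a set $Y$ of $n$ unit vectors in an $l$-dimensional Euclidean space that attains the Welch bound: $\max_{x\ne y\in Y}|\langle x,y\rangle|=\sqrt{\frac{n-l}{l(n-1)}}$.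 A strongly regular graph with parameters $(v,r,\lambda,\mu)$ is an $r$-regular graph on $v$ vertices in which any two distinct vertices have $\lambda$ common neighbours if they are adjacent and $\mu$ if they are not. Statement. Let $d=k^2-2$, where $k>3$ is an odd integer, and let $D\subset\mathbb S^{d-1}$ be a tight spherical $5$-design of minimal type. Then: (i) There exists an ETF with parameters $\left(d-1,\frac{(d-1)(d+1)}{3}\right)$. More precisely, for every nonzero $\alpha\in\mathbb R^d$ with $\langle\alpha,x\rangle\in\{0,\pm1\}$ for all $x\in D$, the derived code $\mathcal L_{\alpha,0}(D)$ has a half, and each of its halves is an ETF with these parameters in the $(d-1)$-dimensional space $\alpha^{\perp}$. (ii) There exists a strongly regular graph with parameters $$\left(\tfrac16k^2(k^2-1),\ \tfrac1{12}(k-1)(k-2)(k^2-3),\ \tfrac1{24}(k+2)(k-1)(k-3)(k-5),\ \tfrac1{24}(k^2-1)(k-2)(k-3)\right).$$ (In particular all the parameters in (i) and (ii) are nonnegative integers.) -/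

import Mathlib

/-- A finite nonempty set `X` on the unit sphere of `ℝ^d` is a spherical `t`-design if, for every
real polynomial of degree at most `t`, its average over the sphere (with respect to the normalized
Lebesgue surface measure) equals its average over `X`. -/
structure IsSphericalDesign {d : ℕ} (t : ℕ) (X : Finset (EuclideanSpace ℝ (Fin d))) : Prop where
  nonempty : X.Nonempty
  norm_eq_one : ∀ x ∈ X, ‖x‖ = 1
  average_eq : ∀ p : MvPolynomial (Fin d) ℝ, p.totalDegree ≤ t →
    MeasureTheory.average
        (MeasureTheory.volume : MeasureTheory.Measure (EuclideanSpace ℝ (Fin d))).toSphere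
        (fun x => MvPolynomial.eval (fun i => x.1 i) p)
      = (1 / (X.card : ℝ)) * ∑ x ∈ X, MvPolynomial.eval (fun i => x i) p

/-- A spherical `5`-design in `ℝ^d` is tight if it attains the lower bound
`2 * binom (d + s - 1) s` for the size of a spherical `(2 * s + 1)`-design, where `s = 2`. -/
structure IsTightSphericalFiveDesign {d : ℕ} (X : Finset (EuclideanSpace ℝ (Fin d))) : Prop where
  isSphericalDesign : IsSphericalDesign 5 X
  card_eq : X.card = 2 * (d + 1).choose 2

/-- `α` is a nonzero vector all of whose inner products with the points of `D` are `0`, `1`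
or `-1`. (The zero vector has this property for every `D`, so it is excluded.) -/
def IsMinimalTypeVector {d : ℕ} (D : Finset (EuclideanSpace ℝ (Fin d)))
    (α : EuclideanSpace ℝ (Fin d)) : Prop :=
  α ≠ 0 ∧ ∀ x ∈ D, inner ℝ α x = 0 ∨ inner ℝ α x = 1 ∨ inner ℝ α x = -1

/-- A spherical `5`-design of minimal type. -/
def IsFiveDesignOfMinimalType {d : ℕ} (D : Finset (EuclideanSpace ℝ (Fin d))) : Prop :=
  IsSphericalDesign 5 D ∧ ∃ α, IsMinimalTypeVector D α

/-- The derived code `L_{α,β}(D)`. -/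
noncomputable def derivedCode {d : ℕ} (D : Finset (EuclideanSpace ℝ (Fin d)))
    (α : EuclideanSpace ℝ (Fin d)) (β : ℝ) : Set (EuclideanSpace ℝ (Fin d)) :=
  (fun x => (√(1 - 3 * β ^ 2 / ((d : ℝ) + 2)))⁻¹ • (x - (3 * β / ((d : ℝ) + 2)) • α)) ''
    {x | x ∈ D ∧ inner ℝ α x = β}

/-- `Y` is a half of the antipodal set `S`: it contains exactly one point of each antipodal pair
`{x, -x}` in `S`. -/
def IsHalfOf {d : ℕ} (Y S : Set (EuclideanSpace ℝ (Fin d))) : Prop :=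
  Y ∪ {y | -y ∈ Y} = S ∧ ∀ y ∈ Y, -y ∉ Y

/-- The Welch bound `θ_{n,d}`. -/
noncomputable def welchBound (d n : ℕ) : ℝ :=
  √(((n : ℝ) - d) / ((d : ℝ) * ((n : ℝ) - 1)))

/-- An equiangular tight frame with parameters `(d, n)` in a `d`-dimensional real inner product
space: a set of `n > d` unit vectors whose coherence, the largest `|⟪x, y⟫|` over distinct points
`x, y`, equals the Welch bound. -/
structure IsETF {E : Type*} [NormedAddCommGroup E] [InnerProductSpace ℝ E]
    (d n : ℕ) (X : Finset E) : Prop where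
  finrank_eq : Module.finrank ℝ E = d
  card_eq : X.card = n
  lt_card : d < n
  norm_eq_one : ∀ x ∈ X, ‖x‖ = 1
  coherence_eq :
    IsGreatest {c : ℝ | ∃ x ∈ X, ∃ y ∈ X, x ≠ y ∧ c = |inner ℝ x y|} (welchBound d n)

/-!
Everything follows from the moments `∑ x ∈ D, ⟪a, x⟫ ^ j`, `j ≤ 5`, of a spherical `5`-design.
Reflections preserve the surface measure, so such a moment depends only on `‖a‖`; the odd ones
vanish, and the constants of the second and fourth are found by summing over an orthonormal basis.
Polarization gives `∑ ⟪a, x⟫ * ⟪b, x⟫` and `∑ ⟪a, x⟫ ^ 2 * ⟪b, x⟫ * ⟪c, x⟫`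
(`IsSphericalDesign.sum_inner_mul_inner`, `IsSphericalDesign.sum_inner_sq_mul`).

If `|D| = d * (d + 1)`, the linear programming polynomial `(t + 1) * (t ^ 2 - 1 / (d + 2)) ^ 2` shows
that distinct points of `D` have inner product `-1` or `±1 / √(d + 2)`
(`IsTightSphericalFiveDesign.inner_eq_or`), and the odd moments then show `D = -D`.

For a vector `α` with all `⟪α, x⟫ ∈ {0, ±1}`, the second and fourth moments in the direction `α`
agree, hence `‖α‖ ^ 2 = (d + 2) / 3`. This gives the number of points orthogonal to `α`. A half of
these has no antipodal pair, so all its absolute inner products are `1 / √(d + 2)`, which is exactly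
the Welch bound (`IsMinimalTypeVector.isETF_half`).

For the graph, put `κ = √(d + 2)` and take the points with `⟪α, x⟫ = 1`, joined when their inner
product is `-1 / κ`. Restricted to these points, the polarized moments say that the Gram matrix `g`
has constant row sums and that `g ^ 2` is a combination of `g` and the all-one matrix. As the
adjacency matrix is a combination of `g`, the all-one matrix and the identity, the graph is strongly
regular (`exists_simpleGraph_of_gram`, `IsMinimalTypeVector.exists_isSRGWith`). All parameters are
natural numbers because they are cardinalities.
-/

/-! ### Zonal moments of a spherical design -/

open scoped Pointwise in
/-- A linear isometry preserves the surface measure induced by the Lebesgue measure. -/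
theorem measurePreserving_sphere_map {E : Type*} [NormedAddCommGroup E] [InnerProductSpace ℝ E]
    [FiniteDimensional ℝ E] [MeasurableSpace E] [BorelSpace E] (L : E ≃ₗᵢ[ℝ] E)
    (e : Metric.sphere (0 : E) 1 → Metric.sphere (0 : E) 1) (he : ∀ x, (e x : E) = L x) :
    MeasureTheory.MeasurePreserving e
      (MeasureTheory.volume : MeasureTheory.Measure E).toSphere
      (MeasureTheory.volume : MeasureTheory.Measure E).toSphere := by
  have hcont : Continuous e := by
    refine Continuous.subtype_mk (f := fun x => (e x : E)) ?_ (fun x => (e x).2)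
    simp only [he]
    exact L.continuous.comp continuous_subtype_val
  refine ⟨hcont.measurable, ?_⟩
  ext s hs
  rw [MeasureTheory.Measure.map_apply hcont.measurable hs,
    MeasureTheory.Measure.toSphere_apply' _ hs,
    MeasureTheory.Measure.toSphere_apply' _ (hcont.measurable hs)]
  congr 1
  rw [← L.measurePreserving.measure_preimage_emb L.toHomeomorph.measurableEmbedding
    (Set.Ioo (0 : ℝ) 1 • (Subtype.val '' s))]
  congr 1
  ext y
  simp only [Set.mem_smul, Set.mem_image, Set.mem_preimage]
  constructor
  · rintro ⟨r, hr, _, ⟨x, hx, rfl⟩, rfl⟩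
    exact ⟨r, hr, _, ⟨e x, hx, rfl⟩, by rw [he]; exact (L.map_smul r (x : E)).symm⟩
  · rintro ⟨r, hr, _, ⟨x, hx, rfl⟩, h⟩
    have hy : L y = r • (x : E) := h.symm
    let x' : Metric.sphere (0 : E) 1 := ⟨L.symm x, by simp⟩
    have hx' : e x' = x := Subtype.ext (by rw [he]; simp [x'])
    refine ⟨r, hr, _, ⟨x', by rw [hx']; exact hx, rfl⟩, ?_⟩
    apply L.injective
    rw [hy, L.map_smul]
    simp [x']

/-- The moments of the surface measure in a direction depend only on the length of that
direction, because some reflection carries one of two vectors of equal length to the other. -/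
theorem average_sphere_inner_pow_eq {E : Type*} [NormedAddCommGroup E] [InnerProductSpace ℝ E]
    [FiniteDimensional ℝ E] [MeasurableSpace E] [BorelSpace E] {a b : E} (h : ‖a‖ = ‖b‖) (j : ℕ) :
    MeasureTheory.average (MeasureTheory.volume : MeasureTheory.Measure E).toSphere
        (fun x => (inner ℝ a (x : E)) ^ j) =
      MeasureTheory.average (MeasureTheory.volume : MeasureTheory.Measure E).toSphere
        (fun x => (inner ℝ b (x : E)) ^ j) := by
  let L : E ≃ₗᵢ[ℝ] E := (ℝ ∙ (a - b))ᗮ.reflection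
  have hL : L a = b := Submodule.reflection_sub h
  have hm : ∀ x : Metric.sphere (0 : E) 1, L x ∈ Metric.sphere (0 : E) 1 := fun x => by simp
  have hm' : ∀ x : Metric.sphere (0 : E) 1, L.symm x ∈ Metric.sphere (0 : E) 1 := fun x => by simp
  let e : Metric.sphere (0 : E) 1 ≃ₜ Metric.sphere (0 : E) 1 :=
    { toFun := fun x => ⟨L x, hm x⟩
      invFun := fun x => ⟨L.symm x, hm' x⟩
      left_inv := fun x => by simp
      right_inv := fun x => by simp
      continuous_toFun := (L.continuous.comp continuous_subtype_val).subtype_mk _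
      continuous_invFun := (L.symm.continuous.comp continuous_subtype_val).subtype_mk _ }
  have hp := measurePreserving_sphere_map L e (fun _ => rfl)
  rw [MeasureTheory.average_eq, MeasureTheory.average_eq,
    ← hp.integral_comp e.measurableEmbedding (fun x => (inner ℝ b (x : E)) ^ j)]
  congr 2
  ext x
  change _ = (inner ℝ b (L x)) ^ j
  rw [← hL, L.inner_map_map]

/-- The `j`-th moment of a `t`-design, for `j ≤ t`, depends only on the length of the direction. -/
theorem IsSphericalDesign.sum_inner_pow_eq {d t : ℕ} {D : Finset (EuclideanSpace ℝ (Fin d))}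
    (hD : IsSphericalDesign t D) {j : ℕ} (hj : j ≤ t) {a b : EuclideanSpace ℝ (Fin d)}
    (h : ‖a‖ = ‖b‖) :
    ∑ x ∈ D, (inner ℝ a x) ^ j = ∑ x ∈ D, (inner ℝ b x) ^ j := by
  let p (c : EuclideanSpace ℝ (Fin d)) : MvPolynomial (Fin d) ℝ :=
    (∑ i, MvPolynomial.C (c i) * MvPolynomial.X i) ^ j
  have hp (c x : EuclideanSpace ℝ (Fin d)) :
      MvPolynomial.eval (fun i => x i) (p c) = (inner ℝ c x) ^ j := by
    simp [p, PiLp.inner_apply, mul_comm]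
  have hdeg (c : EuclideanSpace ℝ (Fin d)) : (p c).totalDegree ≤ t := by
    refine (MvPolynomial.totalDegree_pow _ _).trans (le_trans ?_ hj)
    refine (Nat.mul_le_mul_left j ?_).trans (mul_one j).le
    refine MvPolynomial.totalDegree_finsetSum_le fun i _ => ?_
    refine (MvPolynomial.totalDegree_mul _ _).trans ?_
    simp
  have key (c : EuclideanSpace ℝ (Fin d)) := hD.average_eq (p c) (hdeg c)
  simp only [hp] at key
  have hN : (1 / (D.card : ℝ)) ≠ 0 := by
    have := hD.nonempty.card_pos
    positivity
  refine mul_left_cancel₀ hN ?_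
  rw [← key a, ← key b, average_sphere_inner_pow_eq h j]

/-- Odd moments vanish, since opposite directions have the same length. -/
theorem IsSphericalDesign.sum_inner_pow_odd {d t : ℕ} {D : Finset (EuclideanSpace ℝ (Fin d))}
    (hD : IsSphericalDesign t D) {j : ℕ} (hj : j ≤ t) (hodd : Odd j)
    (a : EuclideanSpace ℝ (Fin d)) : ∑ x ∈ D, (inner ℝ a x) ^ j = 0 := by
  have h := hD.sum_inner_pow_eq hj (a := -a) (b := a) (norm_neg a)
  simp only [inner_neg_left, hodd.neg_pow, Finset.sum_neg_distrib] at h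
  linarith

theorem IsSphericalDesign.exists_sum_inner_pow {d t : ℕ} {D : Finset (EuclideanSpace ℝ (Fin d))}
    (hD : IsSphericalDesign t D) (hd : 0 < d) {j : ℕ} (hj : j ≤ t) :
    ∃ C : ℝ, ∀ a, ∑ x ∈ D, (inner ℝ a x) ^ j = C * ‖a‖ ^ j := by
  let u : EuclideanSpace ℝ (Fin d) := EuclideanSpace.single ⟨0, hd⟩ 1
  refine ⟨∑ x ∈ D, (inner ℝ u x) ^ j, fun a => ?_⟩
  rw [hD.sum_inner_pow_eq hj (a := a) (b := ‖a‖ • u) (by simp [u, norm_smul]), Finset.sum_mul]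
  refine Finset.sum_congr rfl fun x _ => ?_
  rw [real_inner_smul_left, mul_pow, mul_comm]

theorem IsSphericalDesign.sum_inner_sq {d t : ℕ} {D : Finset (EuclideanSpace ℝ (Fin d))}
    (hD : IsSphericalDesign t D) (hd : 0 < d) (ht : 2 ≤ t) (a : EuclideanSpace ℝ (Fin d)) :
    ∑ x ∈ D, (inner ℝ a x) ^ 2 = (D.card : ℝ) / d * ‖a‖ ^ 2 := by
  obtain ⟨C, hC⟩ := hD.exists_sum_inner_pow hd ht
  -- The constant is found by summing over an orthonormal basis.
  let b := EuclideanSpace.basisFun (Fin d) ℝ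
  have h1 : ∑ i, ∑ x ∈ D, (inner ℝ (b i) x) ^ 2 = (D.card : ℝ) := by
    rw [Finset.sum_comm]
    have (x) (hx : x ∈ D) : ∑ i, (inner ℝ (b i) x) ^ 2 = 1 := by
      simpa [hD.norm_eq_one x hx] using b.sum_sq_norm_inner_right x
    rw [Finset.sum_congr rfl this]
    simp
  have h2 : (d : ℝ) * C = D.card := by
    rw [← h1]
    simp [hC]
  have : (d : ℝ) ≠ 0 := by positivity
  rw [hC, ← h2]
  field_simp

/-- Polarization of the second moment. -/
theorem IsSphericalDesign.sum_inner_mul_inner {d t : ℕ} {D : Finset (EuclideanSpace ℝ (Fin d))}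
    (hD : IsSphericalDesign t D) (hd : 0 < d) (ht : 2 ≤ t) (a b : EuclideanSpace ℝ (Fin d)) :
    ∑ x ∈ D, inner ℝ a x * inner ℝ b x = (D.card : ℝ) / d * inner ℝ a b := by
  have h1 := hD.sum_inner_sq hd ht (a + b)
  have h2 := hD.sum_inner_sq hd ht (a - b)
  rw [norm_add_sq_real] at h1
  rw [norm_sub_sq_real] at h2
  have h3 : ∑ x ∈ D, inner ℝ a x * inner ℝ b x =
      (∑ x ∈ D, (inner ℝ (a + b) x) ^ 2 - ∑ x ∈ D, (inner ℝ (a - b) x) ^ 2) / 4 := by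
    rw [← Finset.sum_sub_distrib, Finset.sum_div]
    refine Finset.sum_congr rfl fun x _ => ?_
    rw [inner_add_left, inner_sub_left]
    ring
  rw [h3, h1, h2]
  ring

/-- Polarization of a quartic form `C * ‖a‖ ^ 4`. -/
theorem sum_inner_sq_mul_inner_mul_inner {E : Type*} [NormedAddCommGroup E]
    [InnerProductSpace ℝ E] {D : Finset E} {C : ℝ}
    (hC : ∀ a, ∑ x ∈ D, (inner ℝ a x) ^ 4 = C * ‖a‖ ^ 4) (a b c : E) :
    ∑ x ∈ D, (inner ℝ a x) ^ 2 * (inner ℝ b x * inner ℝ c x) =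
      C / 3 * (‖a‖ ^ 2 * inner ℝ b c + 2 * inner ℝ a b * inner ℝ a c) := by
  have hn (v : E) : ‖v‖ ^ 4 = (inner ℝ v v) ^ 2 := by
    rw [real_inner_self_eq_norm_sq]
    ring
  have h3 : ∑ x ∈ D, (inner ℝ a x) ^ 2 * (inner ℝ b x * inner ℝ c x) =
      (∑ x ∈ D, (inner ℝ (a + b + c) x) ^ 4 + ∑ x ∈ D, (inner ℝ (a - b - c) x) ^ 4
        - ∑ x ∈ D, (inner ℝ (a + b - c) x) ^ 4 - ∑ x ∈ D, (inner ℝ (a - b + c) x) ^ 4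
        - 2 * ∑ x ∈ D, (inner ℝ (b + c) x) ^ 4 + 2 * ∑ x ∈ D, (inner ℝ (b - c) x) ^ 4) / 48 := by
    rw [Finset.mul_sum, Finset.mul_sum, ← Finset.sum_add_distrib, ← Finset.sum_sub_distrib,
      ← Finset.sum_sub_distrib, ← Finset.sum_sub_distrib, ← Finset.sum_add_distrib,
      Finset.sum_div]
    refine Finset.sum_congr rfl fun x _ => ?_
    simp only [inner_add_left, inner_sub_left]
    ring
  rw [h3]
  rw [hC, hC, hC, hC, hC, hC]
  simp only [hn, inner_add_left, inner_sub_left, inner_add_right, inner_sub_right]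
  rw [real_inner_comm a b, real_inner_comm a c, real_inner_comm b c,
    ← real_inner_self_eq_norm_sq]
  ring

/-- Polarized fourth moment; the constant is found by summing over pairs of basis vectors. -/
theorem IsSphericalDesign.sum_inner_sq_mul {d t : ℕ} {D : Finset (EuclideanSpace ℝ (Fin d))}
    (hD : IsSphericalDesign t D) (hd : 0 < d) (ht : 4 ≤ t) (a b c : EuclideanSpace ℝ (Fin d)) :
    ∑ x ∈ D, (inner ℝ a x) ^ 2 * (inner ℝ b x * inner ℝ c x) =
      (D.card : ℝ) / (d * (d + 2)) * (‖a‖ ^ 2 * inner ℝ b c + 2 * inner ℝ a b * inner ℝ a c) := by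
  obtain ⟨C, hC⟩ := hD.exists_sum_inner_pow hd ht
  have hpol := sum_inner_sq_mul_inner_mul_inner hC
  let b := EuclideanSpace.basisFun (Fin d) ℝ
  have h1 : ∑ i, ∑ j, ∑ x ∈ D, (inner ℝ (b i) x) ^ 2 * (inner ℝ (b j) x * inner ℝ (b j) x)
      = (D.card : ℝ) := by
    have (x) (hx : x ∈ D) : ∑ i, (inner ℝ (b i) x) ^ 2 = 1 := by
      simpa [hD.norm_eq_one x hx] using b.sum_sq_norm_inner_right x
    have h (i) : ∑ j, ∑ x ∈ D, (inner ℝ (b i) x) ^ 2 * (inner ℝ (b j) x * inner ℝ (b j) x) =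
        ∑ x ∈ D, (inner ℝ (b i) x) ^ 2 := by
      rw [Finset.sum_comm]
      refine Finset.sum_congr rfl fun x hx => ?_
      simp only [← sq]
      rw [← Finset.mul_sum, this x hx, mul_one]
    simp only [h]
    rw [Finset.sum_comm, Finset.sum_congr rfl this]
    simp
  have h2 : C / 3 * (d * (d + 2)) = D.card := by
    rw [← h1]
    simp only [hpol, ← Finset.mul_sum, Finset.sum_add_distrib]
    have hb (i j : Fin d) : inner ℝ (b i) (b j) = if i = j then (1 : ℝ) else 0 :=
      orthonormal_iff_ite.1 b.orthonormal i j
    have hb1 (i : Fin d) : ‖b i‖ = 1 := b.orthonormal.1 i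
    have hdiag (i : Fin d) : ∑ j, (if i = j then (1 : ℝ) else 0) * (if i = j then 1 else 0) = 1 := by
      simp
    simp only [hb, hb1, if_true, mul_assoc, hdiag, ← Finset.mul_sum, Finset.sum_const,
      Finset.card_univ, Fintype.card_fin, nsmul_eq_mul]
    ring
  have : (d : ℝ) * (d + 2) ≠ 0 := by positivity
  rw [hpol, ← h2]
  field_simp

/-! ### Inner products in a tight design -/

theorem IsTightSphericalFiveDesign.card_eq_mul {d : ℕ} {D : Finset (EuclideanSpace ℝ (Fin d))}
    (hD : IsTightSphericalFiveDesign D) : (D.card : ℝ) = d * (d + 1) := by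
  rw [hD.card_eq, Nat.cast_mul, Nat.cast_choose_two]
  push_cast
  ring

/-- The points of a tight `5`-design have only four mutual inner products. The polynomial
`(t + 1) * (t ^ 2 - 1 / (d + 2)) ^ 2` is nonnegative on `[-1, 1]`; for `|D| = d * (d + 1)` its sum
over the inner products with a fixed point equals its value at `1`, so all other terms vanish. -/
theorem IsTightSphericalFiveDesign.inner_eq_or {d : ℕ} {D : Finset (EuclideanSpace ℝ (Fin d))}
    (hD : IsTightSphericalFiveDesign D) (hd : 0 < d) {x y : EuclideanSpace ℝ (Fin d)}
    (hx : x ∈ D) (hy : y ∈ D) (hxy : y ≠ x) :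
    inner ℝ x y = -1 ∨ (inner ℝ x y) ^ 2 = 1 / ((d : ℝ) + 2) := by
  have hdes := hD.isSphericalDesign
  have hd0 : (d : ℝ) ≠ 0 := by positivity
  have hd2 : (d : ℝ) + 2 ≠ 0 := by positivity
  have hN := hD.card_eq_mul
  have hx1 := hdes.norm_eq_one x hx
  let c : ℝ := 1 / ((d : ℝ) + 2)
  let F (y : EuclideanSpace ℝ (Fin d)) : ℝ := (inner ℝ x y + 1) * ((inner ℝ x y) ^ 2 - c) ^ 2
  have h2 := hdes.sum_inner_sq hd (by norm_num) x
  have h4 := hdes.sum_inner_sq_mul hd (by norm_num) x x x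
  rw [hx1, hN] at h2
  rw [real_inner_self_eq_norm_sq, hx1, hN] at h4
  have hsum : ∑ z ∈ D, F z = F x := by
    have h (z) : F z = (inner ℝ x z) ^ 5 - 2 * c * (inner ℝ x z) ^ 3 + c ^ 2 * (inner ℝ x z) ^ 1
        + (inner ℝ x z) ^ 2 * (inner ℝ x z * inner ℝ x z) - 2 * c * (inner ℝ x z) ^ 2 + c ^ 2 := by
      simp only [F]
      ring
    simp only [h, Finset.sum_add_distrib, Finset.sum_sub_distrib, ← Finset.mul_sum,
      hdes.sum_inner_pow_odd (le_refl 5) (by decide),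
      hdes.sum_inner_pow_odd (by norm_num : 3 ≤ 5) (by decide),
      hdes.sum_inner_pow_odd (by norm_num : 1 ≤ 5) (by decide), h2, h4,
      Finset.sum_const, nsmul_eq_mul, hN, real_inner_self_eq_norm_sq, hx1, c]
    field_simp
    ring
  have hnonneg (z) (hz : z ∈ D) : 0 ≤ F z := by
    have := neg_le_of_abs_le (abs_real_inner_le_norm x z)
    rw [hx1, hdes.norm_eq_one z hz] at this
    exact mul_nonneg (by linarith) (sq_nonneg _)
  have hzero : ∑ z ∈ D.erase x, F z = 0 := by
    have := Finset.add_sum_erase D F hx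
    linarith
  have hFy := (Finset.sum_eq_zero_iff_of_nonneg
    (fun z hz => hnonneg z (Finset.mem_of_mem_erase hz))).1 hzero y (Finset.mem_erase.2 ⟨hxy, hy⟩)
  rcases mul_eq_zero.1 hFy with h | h
  · left
    linarith
  · right
    have := pow_eq_zero_iff (two_ne_zero) |>.1 h
    linarith

theorem eq_neg_of_inner_eq_neg_one {E : Type*} [NormedAddCommGroup E] [InnerProductSpace ℝ E]
    {x y : E} (hx : ‖x‖ = 1) (hy : ‖y‖ = 1) (h : inner ℝ x y = -1) : y = -x := by
  have := norm_add_sq_real x y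
  rw [hx, hy, h] at this
  have h0 : x + y = 0 := by
    rw [← norm_eq_zero]
    nlinarith [norm_nonneg (x + y)]
  exact (neg_eq_of_add_eq_zero_right h0).symm

/-- A tight `5`-design is antipodal: the odd polynomial `t ^ 3 - t / (d + 2)` has zero sum over the
inner products with `x`, but only the terms of `x` and `-x` can be nonzero. -/
theorem IsTightSphericalFiveDesign.neg_mem {d : ℕ} {D : Finset (EuclideanSpace ℝ (Fin d))}
    (hD : IsTightSphericalFiveDesign D) (hd : 0 < d) {x : EuclideanSpace ℝ (Fin d)}
    (hx : x ∈ D) : -x ∈ D := by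
  have hdes := hD.isSphericalDesign
  have hx1 := hdes.norm_eq_one x hx
  by_contra hneg
  have hsum : ∑ z ∈ D, ((inner ℝ x z) ^ 3 - 1 / ((d : ℝ) + 2) * (inner ℝ x z) ^ 1) = 0 := by
    rw [Finset.sum_sub_distrib, ← Finset.mul_sum,
      hdes.sum_inner_pow_odd (by norm_num : 3 ≤ 5) (by decide),
      hdes.sum_inner_pow_odd (by norm_num : 1 ≤ 5) (by decide)]
    simp
  rw [Finset.sum_eq_single_of_mem x hx, real_inner_self_eq_norm_sq, hx1] at hsum
  · have hlt : 1 / ((d : ℝ) + 2) < 1 := by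
      rw [div_lt_one (by positivity)]
      have : (0 : ℝ) ≤ d := by positivity
      linarith
    linarith
  · intro z hz hzx
    rcases hD.inner_eq_or hd hx hz hzx with h | h
    · exact absurd (eq_neg_of_inner_eq_neg_one hx1 (hdes.norm_eq_one z hz) h ▸ hz) hneg
    · rw [← h]
      ring

/-! ### Minimal type vectors -/

/-- The second and fourth moments agree in the direction of a minimal type vector, which
determines its length. -/
theorem IsMinimalTypeVector.norm_sq {d : ℕ} {D : Finset (EuclideanSpace ℝ (Fin d))}
    {α : EuclideanSpace ℝ (Fin d)} (hα : IsMinimalTypeVector D α)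
    (hD : IsTightSphericalFiveDesign D) (hd : 0 < d) : ‖α‖ ^ 2 = ((d : ℝ) + 2) / 3 := by
  have hd0 : (0 : ℝ) < d := by positivity
  have h2 := hD.isSphericalDesign.sum_inner_sq hd (by norm_num) α
  have h4 := hD.isSphericalDesign.sum_inner_sq_mul hd (by norm_num) α α α
  have : ∑ x ∈ D, (inner ℝ α x) ^ 2 = ∑ x ∈ D, (inner ℝ α x) ^ 2 * (inner ℝ α x * inner ℝ α x) := by
    refine Finset.sum_congr rfl fun x hx => ?_
    rcases hα.2 x hx with h | h | h <;> rw [h] <;> norm_num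
  rw [h2, h4, real_inner_self_eq_norm_sq, hD.card_eq_mul] at this
  have hpos : 0 < ‖α‖ ^ 2 := by
    have := norm_pos_iff.2 hα.1
    positivity
  have h3 : ‖α‖ ^ 2 * (((d : ℝ) + 2) - 3 * ‖α‖ ^ 2) = 0 := by
    field_simp at this
    linear_combination this
  rcases mul_eq_zero.1 h3 with h | h
  · exact absurd h hpos.ne'
  · linarith

/-- Summation of an even function over an antipodal set can be restricted to one of the two
parallel hyperplanes if the function vanishes between them. -/
theorem IsMinimalTypeVector.sum_eq_two_mul {d : ℕ} {D : Finset (EuclideanSpace ℝ (Fin d))}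
    {α : EuclideanSpace ℝ (Fin d)} (hα : IsMinimalTypeVector D α)
    (hneg : ∀ x ∈ D, -x ∈ D) (F : EuclideanSpace ℝ (Fin d) → ℝ) (hF : ∀ x, F (-x) = F x)
    (h0 : ∀ x, inner ℝ α x = 0 → F x = 0) :
    ∑ x ∈ D, F x = 2 * ∑ x ∈ D with inner ℝ α x = 1, F x := by
  have hsplit : ∑ x ∈ D, F x =
      ∑ x ∈ D with inner ℝ α x = 1, F x + ∑ x ∈ D with inner ℝ α x = -1, F x := by
    rw [Finset.sum_filter, Finset.sum_filter, ← Finset.sum_add_distrib]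
    refine Finset.sum_congr rfl fun x hx => ?_
    rcases hα.2 x hx with h | h | h
    · simp [h, h0 x h]
    · norm_num [h]
    · norm_num [h]
  have hbij : ∑ x ∈ D with inner ℝ α x = -1, F x = ∑ x ∈ D with inner ℝ α x = 1, F x := by
    refine Finset.sum_nbij' (fun x => -x) (fun x => -x) ?_ ?_ ?_ ?_ ?_
    · intro x hx
      rw [Finset.mem_filter] at hx ⊢
      exact ⟨hneg x hx.1, by rw [inner_neg_right, hx.2, neg_neg]⟩
    · intro x hx
      rw [Finset.mem_filter] at hx ⊢
      exact ⟨hneg x hx.1, by rw [inner_neg_right, hx.2]⟩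
    · simp
    · simp
    · simp [hF]
  rw [hsplit, hbij]
  ring

/-! ### Halves of the derived code -/

/-- A half of an antipodal set without zero: well-order the space and keep the smaller point of
each antipodal pair. -/
theorem exists_isHalfOf {d : ℕ} {S : Set (EuclideanSpace ℝ (Fin d))} (hneg : ∀ x ∈ S, -x ∈ S)
    (h0 : (0 : EuclideanSpace ℝ (Fin d)) ∉ S) : ∃ Y, IsHalfOf Y S := by
  let r := @WellOrderingRel (EuclideanSpace ℝ (Fin d))
  refine ⟨{x | x ∈ S ∧ r x (-x)}, ?_, ?_⟩
  · ext x
    simp only [Set.mem_union, Set.mem_ofPred_eq, neg_neg]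
    constructor
    · rintro (h | h)
      · exact h.1
      · simpa using hneg _ h.1
    · intro hx
      rcases trichotomous_of r x (-x) with h | h | h
      · exact Or.inl ⟨hx, h⟩
      · have hx0 := add_eq_zero_iff_eq_neg.2 h
        rw [← two_smul ℝ, smul_eq_zero_iff_right two_ne_zero] at hx0
        exact absurd (hx0 ▸ hx) h0
      · exact Or.inr ⟨hneg x hx, h⟩
  · intro x hx hx'
    have h := hx'.2
    rw [neg_neg] at h
    exact asymm_of r hx.2 h

theorem mem_derivedCode_zero {d : ℕ} {D : Finset (EuclideanSpace ℝ (Fin d))}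
    {α x : EuclideanSpace ℝ (Fin d)} : x ∈ derivedCode D α 0 ↔ x ∈ D ∧ inner ℝ α x = 0 := by
  simp [derivedCode]

theorem exists_isHalfOf_derivedCode_zero {d : ℕ} {D : Finset (EuclideanSpace ℝ (Fin d))}
    (hneg : ∀ x ∈ D, -x ∈ D) (h0 : (0 : EuclideanSpace ℝ (Fin d)) ∉ D)
    (α : EuclideanSpace ℝ (Fin d)) :
    ∃ Y : Finset (Submodule.span ℝ {α})ᗮ,
      IsHalfOf (Subtype.val '' (Y : Set (Submodule.span ℝ {α})ᗮ)) (derivedCode D α 0) := by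
  obtain ⟨Y, hY⟩ := exists_isHalfOf (S := derivedCode D α 0)
    (fun x hx => by
      rw [mem_derivedCode_zero] at hx ⊢
      exact ⟨hneg x hx.1, by rw [inner_neg_right, hx.2, neg_zero]⟩)
    (fun h => h0 (mem_derivedCode_zero.1 h).1)
  have hsub : Y ⊆ derivedCode D α 0 := hY.1 ▸ Set.subset_union_left
  have hfin : Y.Finite := D.finite_toSet.subset fun x hx => (mem_derivedCode_zero.1 (hsub hx)).1
  have hfin' : (Subtype.val ⁻¹' Y : Set (Submodule.span ℝ {α})ᗮ).Finite :=
    hfin.preimage Subtype.val_injective.injOn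
  refine ⟨hfin'.toFinset, ?_⟩
  rw [Set.Finite.coe_toFinset, Set.image_preimage_eq_of_subset]
  · exact hY
  · intro x hx
    rw [Subtype.range_coe]
    exact Submodule.mem_orthogonal_singleton_iff_inner_right.2 (mem_derivedCode_zero.1 (hsub hx)).2

/-- Half of the points orthogonal to `α`: by the second moment, `(d + 1) * ‖α‖ ^ 2` of the
`d * (d + 1)` points are not orthogonal to `α`. -/
theorem IsMinimalTypeVector.card_half {d : ℕ} {D : Finset (EuclideanSpace ℝ (Fin d))}
    {α : EuclideanSpace ℝ (Fin d)} (hα : IsMinimalTypeVector D α)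
    (hD : IsTightSphericalFiveDesign D) (hd : 0 < d) {Y : Finset (Submodule.span ℝ {α})ᗮ}
    (hY : IsHalfOf (Subtype.val '' (Y : Set (Submodule.span ℝ {α})ᗮ)) (derivedCode D α 0)) :
    (Y.card : ℝ) = ((d : ℝ) - 1) * (d + 1) / 3 := by
  classical
  have hd0 : (0 : ℝ) < d := by positivity
  let Z : Finset (EuclideanSpace ℝ (Fin d)) := Y.map (Function.Embedding.subtype _)
  have hZmem (x) : x ∈ Z ↔ x ∈ Subtype.val '' (Y : Set (Submodule.span ℝ {α})ᗮ) := by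
    simp [Z]
  have hunion : D.filter (fun x => inner ℝ α x = 0) = Z ∪ Z.image (fun x => -x) := by
    ext x
    rw [Finset.mem_filter, ← mem_derivedCode_zero, ← hY.1, Finset.mem_union, hZmem, Set.mem_union,
      Set.mem_ofPred_eq, ← hZmem (-x), Finset.mem_image]
    refine or_congr_right ⟨fun h => ⟨-x, h, neg_neg x⟩, ?_⟩
    rintro ⟨z, hz, rfl⟩
    rwa [neg_neg]
  have hdisj : Disjoint Z (Z.image (fun x => -x)) := by
    rw [Finset.disjoint_right]
    intro x hx hx'
    obtain ⟨z, hz, rfl⟩ := Finset.mem_image.1 hx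
    exact hY.2 z ((hZmem z).1 hz) ((hZmem _).1 hx')
  have hcard : ((D.filter (fun x => inner ℝ α x = 0)).card : ℝ) = 2 * Y.card := by
    rw [hunion, Finset.card_union_of_disjoint hdisj, Finset.card_image_of_injective _ neg_injective,
      Finset.card_map]
    push_cast
    ring
  have hcount : ((D.filter (fun x => inner ℝ α x = 0)).card : ℝ) =
      D.card - ∑ x ∈ D, (inner ℝ α x) ^ 2 := by
    rw [Finset.card_filter, Finset.cast_card, Nat.cast_sum, ← Finset.sum_sub_distrib]
    refine Finset.sum_congr rfl fun x hx => ?_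
    rcases hα.2 x hx with h | h | h <;> simp [h]
  rw [hcard, hD.isSphericalDesign.sum_inner_sq hd (by norm_num), hα.norm_sq hD hd,
    hD.card_eq_mul] at hcount
  field_simp at hcount
  linarith

/-- The Welch bound for the parameters of the half is the common value `1 / √(d + 2)` of the
absolute inner products. -/
theorem welchBound_sub_one {d n : ℕ} (hd : 2 < d) (hn : (n : ℝ) = ((d : ℝ) - 1) * (d + 1) / 3) :
    welchBound (d - 1) n = √(1 / ((d : ℝ) + 2)) := by
  have h2 : (2 : ℝ) < d := by exact_mod_cast hd
  rw [welchBound, Nat.cast_sub (by omega), hn]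
  congr 1
  have h1 : (d : ℝ) - 1 ≠ 0 := by linarith
  have h3 : ((d : ℝ) - 1) * (d + 1) / 3 - 1 ≠ 0 := by nlinarith
  have h4 : (d : ℝ) + 2 ≠ 0 := by linarith
  rw [Nat.cast_one, div_eq_div_iff (mul_ne_zero h1 h3) h4]
  ring

theorem IsMinimalTypeVector.isETF_half {d n : ℕ} {D : Finset (EuclideanSpace ℝ (Fin d))}
    {α : EuclideanSpace ℝ (Fin d)} (hα : IsMinimalTypeVector D α)
    (hD : IsTightSphericalFiveDesign D) (hd : 2 < d)
    (hn : (n : ℝ) = ((d : ℝ) - 1) * (d + 1) / 3) {Y : Finset (Submodule.span ℝ {α})ᗮ}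
    (hY : IsHalfOf (Subtype.val '' (Y : Set (Submodule.span ℝ {α})ᗮ)) (derivedCode D α 0)) :
    IsETF (d - 1) n Y := by
  have h2 : (2 : ℝ) < d := by exact_mod_cast hd
  have hd0 : 0 < d := by omega
  have hcard : Y.card = n := by
    have := hα.card_half hD hd0 hY
    rw [← hn] at this
    exact_mod_cast this
  have hlt : d - 1 < n := by
    have : ((d - 1 : ℕ) : ℝ) < n := by
      rw [hn, Nat.cast_sub (by omega), Nat.cast_one]
      nlinarith
    exact_mod_cast this
  have hmem (y) (hy : y ∈ Y) : (y : EuclideanSpace ℝ (Fin d)) ∈ D := by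
    refine (mem_derivedCode_zero (α := α).1 ?_).1
    rw [← hY.1]
    exact Or.inl ⟨y, hy, rfl⟩
  have hnorm (y) (hy : y ∈ Y) : ‖y‖ = 1 := hD.isSphericalDesign.norm_eq_one _ (hmem y hy)
  have hinner (x) (hx : x ∈ Y) (y) (hy : y ∈ Y) (hxy : x ≠ y) :
      |inner ℝ x y| = welchBound (d - 1) n := by
    rw [welchBound_sub_one hd hn, ← Real.sqrt_sq_eq_abs, Submodule.coe_inner]
    rcases hD.inner_eq_or hd0 (hmem x hx) (hmem y hy) (fun h => hxy (Subtype.ext h.symm)) with h | h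
    · -- The value `-1` would put both points of an antipodal pair into the half.
      have hneg := eq_neg_of_inner_eq_neg_one (hnorm x hx) (hnorm y hy) h
      refine absurd ?_ (hY.2 x ⟨x, hx, rfl⟩)
      exact ⟨y, hy, by rw [hneg]; rfl⟩
    · rw [h]
  refine ⟨?_, hcard, hlt, hnorm, ?_, ?_⟩
  · have : Fact (Module.finrank ℝ (EuclideanSpace ℝ (Fin d)) = (d - 1) + 1) :=
      ⟨by rw [finrank_euclideanSpace_fin]; omega⟩
    exact Submodule.finrank_orthogonal_span_singleton hα.1
  · obtain ⟨x, hx, y, hy, hxy⟩ := Finset.one_lt_card.1 (show 1 < Y.card by omega)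
    exact ⟨x, hx, y, hy, hxy, (hinner x hx y hy hxy).symm⟩
  · rintro c ⟨x, hx, y, hy, hxy, rfl⟩
    exact (hinner x hx y hy hxy).le

theorem IsETF.map {E F : Type*} [NormedAddCommGroup E] [InnerProductSpace ℝ E]
    [NormedAddCommGroup F] [InnerProductSpace ℝ F] {l n : ℕ} {X : Finset E} (hX : IsETF l n X)
    (L : E ≃ₗᵢ[ℝ] F) : IsETF l n (X.map L.toEquiv.toEmbedding) := by
  refine ⟨L.toLinearEquiv.finrank_eq.symm.trans hX.finrank_eq, (Finset.card_map _).trans hX.card_eq,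
    hX.lt_card, ?_, ?_⟩
  · intro x hx
    obtain ⟨z, hz, rfl⟩ := Finset.mem_map.1 hx
    exact (L.norm_map z).trans (hX.norm_eq_one z hz)
  · convert hX.coherence_eq using 1
    ext c
    simp only [Set.mem_ofPred_eq, Finset.mem_map_equiv]
    constructor
    · rintro ⟨x, hx, y, hy, hxy, rfl⟩
      exact ⟨L.symm x, hx, L.symm y, hy, fun h => hxy (L.symm.injective h),
        by rw [L.symm.inner_map_map]⟩
    · rintro ⟨x, hx, y, hy, hxy, rfl⟩
      exact ⟨L x, by simpa using hx, L y, by simpa using hy, fun h => hxy (L.injective h),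
        by rw [L.inner_map_map]⟩

/-! ### The strongly regular graph -/

/-- A symmetric matrix with unit diagonal and off-diagonal entries `±1 / κ` whose row sums are
constant and whose square is a combination of itself and the all-one matrix gives a graph, with
adjacency `-1 / κ`, in which degrees and numbers of common neighbours depend only on the matrix
entry. The adjacency matrix is affine in the given one, up to a multiple of the identity. -/
theorem exists_simpleGraph_of_gram {v : ℕ} {κ s p q : ℝ} (hκ : 0 < κ)
    (g : Fin v → Fin v → ℝ) (hsymm : ∀ i j, g i j = g j i) (hdiag : ∀ i, g i i = 1)
    (hoff : ∀ i j, i ≠ j → g i j = 1 / κ ∨ g i j = -(1 / κ)) (hs : ∀ i, ∑ j, g i j = s)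
    (hp : ∀ i i', ∑ j, g i j * g i' j = p * g i i' + q) :
    ∃ (G : SimpleGraph (Fin v)) (_ : DecidableRel G.Adj),
      (∀ i j, G.Adj i j ↔ g i j = -(1 / κ)) ∧
      (∀ i, (G.degree i : ℝ) = (v - κ * s + κ - 1) / 2) ∧
      ∀ i j, i ≠ j → (Fintype.card (G.commonNeighbors i j) : ℝ) =
        (v - 2 * κ * s + κ ^ 2 * (p * g i j + q)) / 4 + (κ - 1) / 2 * (1 - κ * g i j) := by
  have hpos : 0 < 1 / κ := by positivity
  let G : SimpleGraph (Fin v) :=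
    { Adj := fun i j => g i j = -(1 / κ)
      symm := ⟨fun i j h => by rw [hsymm]; exact h⟩
      loopless := ⟨fun i h => by rw [hdiag] at h; linarith⟩ }
  let dec : DecidableRel G.Adj := Classical.decRel _
  let A (i j : Fin v) : ℝ := if G.Adj i j then 1 else 0
  have hA (i j) : A i j = (1 - κ * g i j) / 2 + if i = j then (κ - 1) / 2 else 0 := by
    by_cases hij : i = j
    · subst hij
      rw [if_pos rfl, hdiag]
      simp only [A, SimpleGraph.irrefl, if_false]
      ring
    · rw [if_neg hij]
      rcases hoff i j hij with h | h
      · have : ¬ G.Adj i j := fun h' => by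
          have h'' : g i j = -(1 / κ) := h'
          linarith
        simp only [A, this, if_false, h]
        field_simp
        ring
      · have : G.Adj i j := h
        simp only [A, this, if_true, h]
        field_simp
        ring
  refine ⟨G, dec, fun i j => Iff.rfl, fun i => ?_, fun i j hij => ?_⟩
  · have : (G.degree i : ℝ) = ∑ j, A i j := by
      rw [← SimpleGraph.card_neighborFinset_eq_degree, SimpleGraph.neighborFinset_eq_filter,
        Finset.card_filter, Nat.cast_sum]
      simp [A]
    rw [this]
    simp only [hA, Finset.sum_add_distrib, ← Finset.sum_div, Finset.sum_sub_distrib,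
      ← Finset.mul_sum, hs]
    simp
    ring
  · have : (Fintype.card (G.commonNeighbors i j) : ℝ) = ∑ w, A i w * A j w := by
      rw [Fintype.card_of_subtype (Finset.univ.filter fun w => G.Adj i w ∧ G.Adj j w)
        (fun w => by simp [SimpleGraph.mem_commonNeighbors]), Finset.card_filter, Nat.cast_sum]
      refine Finset.sum_congr rfl fun w _ => ?_
      by_cases h1 : G.Adj i w <;> by_cases h2 : G.Adj j w <;> simp [A, h1, h2]
    rw [this]
    -- The product of the two diagonal corrections vanishes because `i ≠ j`.
    have hprod (w) : A i w * A j w = (1 - κ * g i w - κ * g j w + κ ^ 2 * (g i w * g j w)) / 4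
        + ((if i = w then (κ - 1) / 2 * ((1 - κ * g j w) / 2) else 0)
          + if j = w then (κ - 1) / 2 * ((1 - κ * g i w) / 2) else 0) := by
      rw [hA, hA]
      by_cases h1 : i = w
      · have h2 : j ≠ w := fun h => hij (h1.trans h.symm)
        simp only [h1, h2, if_true, if_false]
        ring
      · by_cases h2 : j = w
        · simp only [h1, h2, if_true, if_false]
          ring
        · simp only [h1, h2, if_false]
          ring
    simp only [hprod, Finset.sum_add_distrib, ← Finset.sum_div, Finset.sum_sub_distrib,
      ← Finset.mul_sum, hs, hp, Finset.sum_ite_eq, Finset.mem_univ, if_true, hsymm j i]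
    simp
    ring

/-- The second moment in the direction `α` counts the points on each of the two hyperplanes. -/
theorem IsMinimalTypeVector.card_filter_inner_eq_one {d : ℕ}
    {D : Finset (EuclideanSpace ℝ (Fin d))} {α : EuclideanSpace ℝ (Fin d)}
    (hα : IsMinimalTypeVector D α) (hD : IsTightSphericalFiveDesign D) (hd : 0 < d) :
    ((D.filter (fun x => inner ℝ α x = 1)).card : ℝ) = ((d : ℝ) + 1) * (d + 2) / 6 := by
  have hd0 : (0 : ℝ) < d := by positivity
  have h := hα.sum_eq_two_mul (fun x hx => hD.neg_mem hd hx) (fun x => (inner ℝ α x) ^ 2)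
    (by simp) (by simp_all)
  have h1 : ∑ x ∈ D with inner ℝ α x = 1, (inner ℝ α x) ^ 2 =
      ((D.filter (fun x => inner ℝ α x = 1)).card : ℝ) := by
    rw [Finset.cast_card]
    refine Finset.sum_congr rfl fun x hx => ?_
    rw [(Finset.mem_filter.1 hx).2, one_pow]
  rw [hD.isSphericalDesign.sum_inner_sq hd (by norm_num), hα.norm_sq hD hd, hD.card_eq_mul,
    h1] at h
  field_simp at h
  linarith

/-- The graph on the points `x` of `D` with `⟪α, x⟫ = 1`, adjacent when `⟪x, y⟫ = -1 / κ`. The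
moments of `D` restrict to this half of the nonorthogonal points, which gives the sums required
for the Gram matrix. -/
theorem IsMinimalTypeVector.exists_simpleGraph {d v : ℕ} {κ : ℝ}
    {D : Finset (EuclideanSpace ℝ (Fin d))} {α : EuclideanSpace ℝ (Fin d)}
    (hα : IsMinimalTypeVector D α) (hD : IsTightSphericalFiveDesign D) (hd : 0 < d) (hκ : 0 < κ)
    (hκd : κ ^ 2 = (d : ℝ) + 2) (hv : (D.filter (fun x => inner ℝ α x = 1)).card = v) :
    ∃ (G : SimpleGraph (Fin v)) (_ : DecidableRel G.Adj),
      (∀ i, (G.degree i : ℝ) = (κ - 1) * (κ - 2) * (κ ^ 2 - 3) / 12) ∧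
      (∀ i j, G.Adj i j → (Fintype.card (G.commonNeighbors i j) : ℝ) =
        (κ + 2) * (κ - 1) * (κ - 3) * (κ - 5) / 24) ∧
      ∀ i j, i ≠ j → ¬ G.Adj i j → (Fintype.card (G.commonNeighbors i j) : ℝ) =
        (κ ^ 2 - 1) * (κ - 2) * (κ - 3) / 24 := by
  have hdes := hD.isSphericalDesign
  have hd0 : (0 : ℝ) < d := by positivity
  have hdκ : (d : ℝ) = κ ^ 2 - 2 := by linarith
  have hneg : ∀ x ∈ D, -x ∈ D := fun x hx => hD.neg_mem hd hx
  have hαα := hα.norm_sq hD hd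
  let S := D.filter (fun x => inner ℝ α x = 1)
  let e : Fin v ≃ S := (Fintype.equivFinOfCardEq (by simpa using hv)).symm
  let u (i : Fin v) : EuclideanSpace ℝ (Fin d) := e i
  have huD (i) : u i ∈ D := (Finset.mem_filter.1 (e i).2).1
  have huα (i) : inner ℝ α (u i) = 1 := (Finset.mem_filter.1 (e i).2).2
  have hu1 (i) : ‖u i‖ = 1 := hdes.norm_eq_one _ (huD i)
  have hsumS (F : EuclideanSpace ℝ (Fin d) → ℝ) : ∑ i : Fin v, F (u i) = ∑ x ∈ S, F x :=
    (Equiv.sum_comp e (fun x : S => F x)).trans (Finset.sum_coe_sort S F)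
  have hcard : (v : ℝ) = κ ^ 2 * (κ ^ 2 - 1) / 6 := by
    rw [← hv, hα.card_filter_inner_eq_one hD hd, hκd]
    ring
  have hs (i) : ∑ j, inner ℝ (u i) (u j) = (κ ^ 2 - 1) / 2 := by
    have h := hα.sum_eq_two_mul hneg (fun x => inner ℝ α x * inner ℝ (u i) x) (by simp)
      (by simp_all)
    rw [hdes.sum_inner_mul_inner hd (by norm_num), ← hsumS] at h
    simp only [huα, one_mul, hD.card_eq_mul] at h
    field_simp at h
    rw [hdκ] at h
    linarith
  have hp (i i') : ∑ j, inner ℝ (u i) (u j) * inner ℝ (u i') (u j) =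
      (κ ^ 2 - 1) / 6 * inner ℝ (u i) (u i') + (κ ^ 2 - 1) / κ ^ 2 := by
    have h := hα.sum_eq_two_mul hneg
      (fun x => (inner ℝ α x) ^ 2 * (inner ℝ (u i) x * inner ℝ (u i') x)) (by simp) (by simp_all)
    rw [hdes.sum_inner_sq_mul hd (by norm_num), ← hsumS] at h
    simp only [huα, one_mul, one_pow, mul_one, hD.card_eq_mul, hαα, ← hκd] at h
    field_simp at h
    rw [hdκ] at h
    field_simp
    linarith
  have hoff (i j) (hij : i ≠ j) :
      inner ℝ (u i) (u j) = 1 / κ ∨ inner ℝ (u i) (u j) = -(1 / κ) := by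
    have hne : u j ≠ u i := fun h => hij (e.injective (Subtype.ext h)).symm
    rcases hD.inner_eq_or hd (huD i) (huD j) hne with h | h
    · have := huα j
      rw [eq_neg_of_inner_eq_neg_one (hu1 i) (hu1 j) h, inner_neg_right, huα] at this
      norm_num at this
    · rw [← hκd, ← one_div_pow] at h
      exact sq_eq_sq_iff_eq_or_eq_neg.1 h
  obtain ⟨G, dec, hadj, hdeg, hcom⟩ := exists_simpleGraph_of_gram hκ
    (fun i j => inner ℝ (u i) (u j)) (fun i j => real_inner_comm _ _)
    (fun i => by rw [real_inner_self_eq_norm_sq, hu1]; norm_num) hoff hs hp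
  refine ⟨G, dec, fun i => ?_, fun i j h => ?_, fun i j hij h => ?_⟩
  · rw [hdeg, hcard]
    ring
  · rw [hcom i j h.ne, (hadj i j).1 h, hcard]
    field_simp
    ring
  · rw [hcom i j hij, (hoff i j hij).resolve_right (fun h' => h ((hadj i j).2 h')), hcard]
    field_simp
    ring

/-- The parameters are natural numbers because they count: for `κ > 3` the graph has both
adjacent pairs and nonadjacent pairs of distinct vertices. -/
theorem IsMinimalTypeVector.exists_isSRGWith {d : ℕ} {κ : ℝ}
    {D : Finset (EuclideanSpace ℝ (Fin d))} {α : EuclideanSpace ℝ (Fin d)}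
    (hα : IsMinimalTypeVector D α) (hD : IsTightSphericalFiveDesign D) (hd : 0 < d) (hκ : 3 < κ)
    (hκd : κ ^ 2 = (d : ℝ) + 2) :
    ∃ v r l m : ℕ,
      (v : ℝ) = κ ^ 2 * (κ ^ 2 - 1) / 6 ∧
      (r : ℝ) = (κ - 1) * (κ - 2) * (κ ^ 2 - 3) / 12 ∧
      (l : ℝ) = (κ + 2) * (κ - 1) * (κ - 3) * (κ - 5) / 24 ∧
      (m : ℝ) = (κ ^ 2 - 1) * (κ - 2) * (κ - 3) / 24 ∧
      ∃ (G : SimpleGraph (Fin v)) (_ : DecidableRel G.Adj), G.IsSRGWith v r l m := by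
  have hκ0 : 0 < κ := by linarith
  have hκ2 : 9 < κ ^ 2 := by nlinarith
  obtain ⟨v, hv⟩ : ∃ v, (D.filter (fun x => inner ℝ α x = 1)).card = v := ⟨_, rfl⟩
  have hcard : (v : ℝ) = κ ^ 2 * (κ ^ 2 - 1) / 6 := by
    rw [← hv, hα.card_filter_inner_eq_one hD hd, hκd]
    ring
  obtain ⟨G, dec, hdeg, hadj, hnadj⟩ := hα.exists_simpleGraph hD hd hκ0 hκd hv
  have hvpos : 0 < v := by
    have : (0 : ℝ) < v := by
      rw [hcard]
      have : 0 < κ ^ 2 - 1 := by linarith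
      positivity
    exact_mod_cast this
  let i : Fin v := ⟨0, hvpos⟩
  have hr : 0 < (κ - 1) * (κ - 2) * (κ ^ 2 - 3) / 12 := by
    have h1 : 0 < κ - 1 := by linarith
    have h2 : 0 < κ - 2 := by linarith
    have h3 : 0 < κ ^ 2 - 3 := by linarith
    positivity
  have hlt : G.degree i + 1 < v := by
    have : (G.degree i : ℝ) + 1 < v := by
      rw [hdeg, hcard]
      -- The number of vertices distinct from and not adjacent to `i`.
      have : 0 < (κ + 1) * (κ + 2) * (κ ^ 2 - 3) := by
        have : 0 < κ ^ 2 - 3 := by linarith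
        positivity
      nlinarith
    exact_mod_cast this
  obtain ⟨j, hj⟩ : ∃ j, G.Adj i j := by
    rw [← SimpleGraph.degree_pos_iff_exists_adj]
    have : (0 : ℝ) < G.degree i := by rw [hdeg]; exact hr
    exact_mod_cast this
  obtain ⟨j', hj'⟩ : ∃ j', j' ∉ insert i (G.neighborFinset i) := by
    by_contra! h
    have := Finset.card_le_card (fun x _ => h x : Finset.univ ⊆ insert i (G.neighborFinset i))
    rw [Finset.card_univ, Fintype.card_fin] at this
    have h2 := Finset.card_insert_le i (G.neighborFinset i)
    rw [SimpleGraph.card_neighborFinset_eq_degree] at h2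
    omega
  rw [Finset.mem_insert, SimpleGraph.mem_neighborFinset, not_or] at hj'
  refine ⟨v, G.degree i, Fintype.card (G.commonNeighbors i j),
    Fintype.card (G.commonNeighbors i j'), hcard, hdeg i, hadj i j hj,
    hnadj i j' (Ne.symm hj'.1) hj'.2, G, dec, Fintype.card_fin v, fun a => ?_, fun a b h => ?_,
    fun a b hab h => ?_⟩
  · have := (hdeg a).trans (hdeg i).symm
    exact_mod_cast this
  · have := (hadj a b h).trans (hadj i j hj).symm
    exact_mod_cast this
  · have := (hnadj a b hab h).trans (hnadj i j' (Ne.symm hj'.1) hj'.2).symm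
    exact_mod_cast this

theorem mainTheorem2 (k d : ℕ) (hk : 3 < k) (hodd : Odd k) (hd : d = k ^ 2 - 2)
    (D : Finset (EuclideanSpace ℝ (Fin d)))
    (hD : IsTightSphericalFiveDesign D) (hmin : IsFiveDesignOfMinimalType D) :
    (∃ n : ℕ, (n : ℚ) = ((d : ℚ) - 1) * ((d : ℚ) + 1) / 3 ∧
      (∃ X : Finset (EuclideanSpace ℝ (Fin (d - 1))), IsETF (d - 1) n X) ∧
      ∀ α : EuclideanSpace ℝ (Fin d), IsMinimalTypeVector D α →
        (∃ Y : Finset (Submodule.span ℝ {α})ᗮ,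
          IsHalfOf (Subtype.val '' (Y : Set (Submodule.span ℝ {α})ᗮ)) (derivedCode D α 0)) ∧
        ∀ Y : Finset (Submodule.span ℝ {α})ᗮ,
          IsHalfOf (Subtype.val '' (Y : Set (Submodule.span ℝ {α})ᗮ)) (derivedCode D α 0) →
            IsETF (d - 1) n Y) ∧
    (∃ v r l m : ℕ,
      (v : ℚ) = (k : ℚ) ^ 2 * ((k : ℚ) ^ 2 - 1) / 6 ∧
      (r : ℚ) = ((k : ℚ) - 1) * ((k : ℚ) - 2) * ((k : ℚ) ^ 2 - 3) / 12 ∧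
      (l : ℚ) = ((k : ℚ) + 2) * ((k : ℚ) - 1) * ((k : ℚ) - 3) * ((k : ℚ) - 5) / 24 ∧
      (m : ℚ) = ((k : ℚ) ^ 2 - 1) * ((k : ℚ) - 2) * ((k : ℚ) - 3) / 24 ∧
      ∃ (G : SimpleGraph (Fin v)) (_ : DecidableRel G.Adj), G.IsSRGWith v r l m) := by
  have hk2 : 9 < k ^ 2 := by nlinarith
  have hd2 : 2 < d := by omega
  have hd0 : 0 < d := by omega
  have hkd : (k : ℝ) ^ 2 = (d : ℝ) + 2 := by
    have : k ^ 2 = d + 2 := by omega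
    exact_mod_cast this
  obtain ⟨-, α, hα⟩ := hmin
  have hneg : ∀ x ∈ D, -x ∈ D := fun x hx => hD.neg_mem hd0 hx
  have h0 : (0 : EuclideanSpace ℝ (Fin d)) ∉ D := fun h => by
    have := hD.isSphericalDesign.norm_eq_one 0 h
    simp at this
  refine ⟨?_, ?_⟩
  · obtain ⟨Y, hY⟩ := exists_isHalfOf_derivedCode_zero hneg h0 α
    have hn := hα.card_half hD hd0 hY
    have hETF := hα.isETF_half hD hd2 hn hY
    refine ⟨Y.card, ?_, ⟨_, hETF.map
      ((stdOrthonormalBasis ℝ _).reindex (finCongr hETF.finrank_eq)).repr⟩, fun β hβ =>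
      ⟨exists_isHalfOf_derivedCode_zero hneg h0 β, fun Z hZ => hβ.isETF_half hD hd2 hn hZ⟩⟩
    apply Rat.cast_injective (α := ℝ)
    push_cast
    exact hn
  · obtain ⟨v, r, l, m, hv, hr, hl, hm, hG⟩ :=
      hα.exists_isSRGWith hD hd0 (κ := k) (by exact_mod_cast hk) hkd
    refine ⟨v, r, l, m, ?_, ?_, ?_, ?_, hG⟩ <;> apply Rat.cast_injective (α := ℝ) <;>
      push_cast <;> assumption
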